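/- Let $n\ge 0$, let $R$ be a commutative ring with unit containing $\mathbb{Q}$, and let $G=(G_1,\dots,G_n)$ be power series in $R[[u_1,\dots,u_n]]$. There is a unique system $F=(F_1,\dots,F_n)$ of power series in $R[[X_1,\dots,X_n]]$ without constant term such that $F_i=X_i\,G_i(F)$ for $1\le i\le n$. For multiindices $\alpha,\beta\in\mathbb{N}^n$, define the formal Gaussian integral with identity covariance of a monomial by $$\int d\overline u\,du\ e^{-\overline u u}\ \overline u^{\alpha}u^{\beta}=\sum_{\sigma}\ \prod_{k=1}^{|\alpha|}\delta_{\tau'(\sigma(k)),\,\tau(k)}\in R,$$ where $\tau:\{1,\dots,|\alpha|\}\to\{1,\dots,n\}$ and $\tau':\{1,\dots,|\beta|\}\to\{1,\dots,n\}$ are any maps taking each value $i$ exactly $\alpha_i$, respectively $\beta_i$, times, and $\sigma$ runs over all bijections $\{1,\dots,|\alpha|\}\to\{1,\dots,|\beta|\}$. For $U=\sum_{\alpha,\beta}U_{\alpha\beta}(X)\,\overline u^{\alpha}u^{\beta}\in R[[\overline u,u,X]]$ put $$\int d\overline u\,du\ e^{-\overline u u}\ U=\sum_{\alpha,\beta}U_{\alpha\beta}(X)\int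 d\overline u\,du\ e^{-\overline u u}\ \overline u^{\alpha}u^{\beta}$$ whenever this family is summable in $R[[X]]$ (for coefficientwise convergence, $R$ being discrete). Let $\overline u XG(u)=\sum_{i=1}^n\overline u_iX_iG_i(u)$, and let $X\partial G(F)$ be the $n\times n$ matrix over $R[[X]]$ with entries $X_i\,\frac{\partial G_i}{\partial u_j}(F)$. Then the formal integral $$Z=\int d\overline u\,du\ e^{-\overline u u}\ e^{\overline u XG(u)}$$ is well defined, that is, the family defining it is summable in $R[[X]]$; the determinant $\det(I-X\partial G(F))$ is invertible in $R[[X]]$; and $$Z=\frac{1}{\det\bigl(I-X\partial G(F)\bigr)}.$$ -/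

import Mathlib

namespace LagrangeGood

noncomputable section

/-- The variables of the big power series ring: `ū₁,…,ūₙ`, `u₁,…,uₙ`, `X₁,…,Xₙ`, in this order. -/
abbrev Var (n : ℕ) : Type := Fin n ⊕ Fin n ⊕ Fin n

/-- The ring `R[[ū, u, X]]`. -/
abbrev BigRing (n : ℕ) (R : Type*) : Type _ := MvPowerSeries (Var n) R

variable {n : ℕ} {R : Type*} [CommRing R]

/-- The indeterminate `ūᵢ`. -/
def ubar (i : Fin n) : BigRing n R := MvPowerSeries.X (Sum.inl i)

/-- The indeterminate `uᵢ`. -/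
def uvar (i : Fin n) : BigRing n R := MvPowerSeries.X (Sum.inr (Sum.inl i))

/-- The indeterminate `Xᵢ` in the big ring. -/
def xvar (i : Fin n) : BigRing n R := MvPowerSeries.X (Sum.inr (Sum.inr i))

/-- The formal Gaussian integral `∫ dū du e^{-ūAu} ū^α u^β ∈ R` of a monomial, with covariance
`A⁻¹`: the sum over all bijections (Wick contractions) between the `|α|` factors of `ū^α` and the
`|β|` factors of `u^β` of the product of the covariances, times `(det A)⁻¹`. The factors of `ū^α`
are indexed by `Σ i, Fin (α i)`, the factor `⟨i, r⟩` being the `r`-th copy of `ūᵢ`. -/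
def gaussMonomial (A : GL (Fin n) R) (α β : Fin n →₀ ℕ) : R :=
  (↑(Matrix.GeneralLinearGroup.det A)⁻¹ : R) *
    ∑ σ : (Σ i, Fin (α i)) ≃ (Σ i, Fin (β i)),
      ∏ k : Σ i, Fin (α i), (↑A⁻¹ : Matrix (Fin n) (Fin n) R) (σ k).1 k.1

/-- The coefficient of `ū^α u^β` in `U ∈ R[[ū, u, X]]`, as an element of `R[[X]]`. -/
def coeffX (U : BigRing n R) (α β : Fin n →₀ ℕ) : MvPowerSeries (Fin n) R :=
  fun γ => MvPowerSeries.coeff (α.sumElim (β.sumElim γ)) U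

/-- The term of index `(α, β)` in the family whose sum is the formal Gaussian integral of `U`. -/
def gaussTerm (A : GL (Fin n) R) (U : BigRing n R) (p : (Fin n →₀ ℕ) × (Fin n →₀ ℕ)) :
    MvPowerSeries (Fin n) R :=
  MvPowerSeries.C (gaussMonomial A p.1 p.2) * coeffX U p.1 p.2

open scoped MvPowerSeries.WithPiTopology in
/-- `U` is formally integrable: the family defining its formal Gaussian integral is summable in
`R[[X]]`, for the usual topology (that of coefficientwise convergence, `R` being discrete). -/
def GaussIntegrable (A : GL (Fin n) R) (U : BigRing n R) : Prop :=
  letI : TopologicalSpace R := ⊥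
  Summable (gaussTerm A U)

open scoped MvPowerSeries.WithPiTopology in
/-- The formal Gaussian integral `∫ dū du e^{-ūAu} U ∈ R[[X]]` of `U ∈ R[[ū, u, X]]`
(meaningful if `GaussIntegrable A U`). -/
def gaussIntegral (A : GL (Fin n) R) (U : BigRing n R) : MvPowerSeries (Fin n) R :=
  letI : TopologicalSpace R := ⊥
  ∑' p, gaussTerm A U p

/-- The element `ū X G(u) = ∑ᵢ ūᵢ Xᵢ Gᵢ(u)` of `R[[ū, u, X]]`. -/
def action (G : Fin n → MvPowerSeries (Fin n) R) : BigRing n R :=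
  ∑ i, ubar i * xvar i * MvPowerSeries.subst (uvar : Fin n → BigRing n R) (G i)

/-- The element `exp (ū X G(u))` of `R[[ū, u, X]]`. -/
def expAction [Algebra ℚ R] (G : Fin n → MvPowerSeries (Fin n) R) : BigRing n R :=
  (PowerSeries.exp R).subst (action G)

/-- The partition function `Z = ∫ dū du e^{-ūu} e^{ūXG(u)}`. -/
def partitionFunction [Algebra ℚ R] (G : Fin n → MvPowerSeries (Fin n) R) :
    MvPowerSeries (Fin n) R :=
  gaussIntegral 1 (expAction G)

/-- `F` is a system of power series without constant term with `Fᵢ = Xᵢ Gᵢ(F)` for all `i`. -/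
def IsImplicitSolution (G F : Fin n → MvPowerSeries (Fin n) R) : Prop :=
  (∀ i, MvPowerSeries.constantCoeff (F i) = 0) ∧
    ∀ i, F i = MvPowerSeries.X i * MvPowerSeries.subst F (G i)

/-- The matrix `X∂G(F)`, with entries `Xᵢ (∂ⱼGᵢ)(F)`. -/
def xJacobian (G F : Fin n → MvPowerSeries (Fin n) R) :
    Matrix (Fin n) (Fin n) (MvPowerSeries (Fin n) R) :=
  Matrix.of fun i j =>
    MvPowerSeries.X i * MvPowerSeries.subst F (MvPowerSeries.pderiv R j (G i))

end

end LagrangeGood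

/-!
Write `[u^γ]` for the coefficient of `u^γ` and put `D H = ∑_γ X^γ [u^γ] (H G^γ)`. Only contractions
of `ū^γ` with `u^γ` survive in the Gaussian integral, and their number `γ!` cancels the denominators
of the exponential, so `Z = D 1`.

Shifting `γ` gives `D (Xᵢ H) = Xᵢ D (Gᵢ H)`, the relation satisfied by `H ↦ H(F)` because
`Fᵢ = Xᵢ Gᵢ(F)`; hence `D H = H(F) D 1`. Used in the opposite direction on the expansion of
`det (1 - X∂G(F)) D 1`, this identity eliminates `F`: the coefficient of `X^γ` becomes that of
`det (δᵢⱼ Gᵢ^γᵢ - Xᵢ ∂ⱼGᵢ Gᵢ^(γᵢ - 1))`. Up to the factor `∏ γᵢ` and a conjugation by the `Xᵢ` this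
is `det (γᵢ δᵢⱼ Gᵢ^γᵢ - Xⱼ ∂ⱼ(Gᵢ^γᵢ))`. Its coefficient of `X^γ` is a combination of the integers
`det (γᵢ δᵢⱼ - lᵢⱼ)` with `∑ᵢ lᵢ = γ`, whose columns sum to zero, so it vanishes unless `γ = 0`.
-/

namespace LagrangeGood

open MvPowerSeries

section Order

variable {σ τ R : Type*} [CommRing R]

theorem eq_of_forall_natCast_le_order_sub {f g : MvPowerSeries σ R}
    (h : ∀ k : ℕ, (k : ℕ∞) ≤ (f - g).order) : f = g :=
  sub_eq_zero.mp (order_eq_top_iff.mp (ENat.eq_top_iff_forall_ge.mpr h))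

theorem natCast_le_order_sub_trans {k : ℕ} {f g h : MvPowerSeries σ R}
    (hfg : (k : ℕ∞) ≤ (f - g).order) (hgh : (k : ℕ∞) ≤ (g - h).order) :
    (k : ℕ∞) ≤ (f - h).order := by
  rw [← sub_add_sub_cancel f g h]
  exact (le_min hfg hgh).trans (min_order_le_add)

theorem exists_forall_natCast_le_order_sub (a : ℕ → MvPowerSeries σ R)
    (ha : ∀ k : ℕ, (k : ℕ∞) ≤ (a (k + 1) - a k).order) :
    ∃ f : MvPowerSeries σ R, ∀ k : ℕ, (k : ℕ∞) ≤ (f - a k).order := by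
  have hmono {k m : ℕ} (hkm : k ≤ m) : (k : ℕ∞) ≤ (a m - a k).order := by
    induction m, hkm using Nat.le_induction with
    | base => simp
    | succ m hm ih => exact natCast_le_order_sub_trans ((Nat.cast_le.mpr hm).trans (ha m)) ih
  let f : MvPowerSeries σ R := fun d => coeff d (a (d.degree + 1))
  refine ⟨f, fun k => nat_le_order fun d hd => ?_⟩
  have hf : coeff d f = coeff d (a (d.degree + 1)) := coeff_apply f d
  have hd' : coeff d (a k - a (d.degree + 1)) = 0 :=
    coeff_of_lt_order ((Nat.cast_lt.mpr d.degree.lt_succ_self).trans_le (hmono hd))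
  rw [map_sub] at hd' ⊢
  rw [hf, ← neg_sub, hd', neg_zero]

theorem natCast_add_one_le_order_mul {m f : MvPowerSeries σ R} {k : ℕ}
    (hm : constantCoeff m = 0) (hf : (k : ℕ∞) ≤ f.order) :
    ((k + 1 : ℕ) : ℕ∞) ≤ (m * f).order := by
  rw [add_comm, Nat.cast_add, Nat.cast_one]
  exact (add_le_add (one_le_order_iff_constCoeff_eq_zero.mpr hm) hf).trans le_order_mul

theorem natCast_le_order_sub_iff_truncTotal_eq [Finite σ] {f g : MvPowerSeries σ R} {k : ℕ} :
    (k : ℕ∞) ≤ (f - g).order ↔ truncTotal k f = truncTotal k g := by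
  refine ⟨fun h => MvPolynomial.ext _ _ fun d => ?_, fun h => nat_le_order fun d hd => ?_⟩
  · rw [coeff_truncTotal_eq_ite, coeff_truncTotal_eq_ite]
    refine if_ctx_congr Iff.rfl (fun hd => ?_) fun _ => rfl
    rw [← sub_eq_zero, ← map_sub]
    exact coeff_of_lt_order ((Nat.cast_lt.mpr hd).trans_le h)
  · rw [map_sub, ← coeff_truncTotal f hd, h, coeff_truncTotal g hd, sub_self]

theorem natCast_le_order_sub_truncTotal [Finite σ] (f : MvPowerSeries σ R) (k : ℕ) :
    (k : ℕ∞) ≤ (f - (truncTotal k f : MvPowerSeries σ R)).order :=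
  nat_le_order fun d hd => by
    rw [map_sub, MvPolynomial.coeff_coe, coeff_truncTotal f hd, sub_self]

theorem natCast_le_order_subst_sub_subst [Finite σ] [Finite τ] {a b : σ → MvPowerSeries τ R}
    {k : ℕ} (ha : ∀ i, constantCoeff (a i) = 0) (hb : ∀ i, constantCoeff (b i) = 0)
    (hab : ∀ i, (k : ℕ∞) ≤ (a i - b i).order) (f : MvPowerSeries σ R) :
    (k : ℕ∞) ≤ (f.subst a - f.subst b).order := by
  have htrunc (i : σ) := natCast_le_order_sub_iff_truncTotal_eq.mp (hab i)
  rw [natCast_le_order_sub_iff_truncTotal_eq, truncTotal_subst ha, truncTotal_subst hb]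
  simp only [htrunc]

theorem order_le_order_subst {a : σ → MvPowerSeries τ R} (ha : HasSubst a)
    (ha₀ : ∀ i, constantCoeff (a i) = 0) (f : MvPowerSeries σ R) :
    f.order ≤ (f.subst a).order :=
  calc f.order = 1 * f.order := (one_mul _).symm
    _ ≤ (⨅ i, (a i).order) * f.order :=
      mul_le_mul_left (le_iInf fun i => one_le_order_iff_constCoeff_eq_zero.mpr (ha₀ i)) _
    _ ≤ (f.subst a).order := le_order_subst ha f

end Order

section ImplicitEquation

variable {σ τ R : Type*} [Finite σ] [Finite τ] [CommRing R] {m : σ → MvPowerSeries τ R}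

theorem natCast_add_one_le_order_mul_subst_sub {F F' : σ → MvPowerSeries τ R} {k : ℕ}
    (hm : ∀ i, constantCoeff (m i) = 0) (hF : ∀ i, constantCoeff (F i) = 0)
    (hF' : ∀ i, constantCoeff (F' i) = 0) (h : ∀ i, (k : ℕ∞) ≤ (F i - F' i).order)
    (G : σ → MvPowerSeries σ R) (i : σ) :
    ((k + 1 : ℕ) : ℕ∞) ≤ (m i * (G i).subst F - m i * (G i).subst F').order := by
  rw [← mul_sub]
  exact natCast_add_one_le_order_mul (hm i) (natCast_le_order_subst_sub_subst hF hF' h (G i))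

theorem eq_of_eq_mul_subst {G : σ → MvPowerSeries σ R} {F F' : σ → MvPowerSeries τ R}
    (hm : ∀ i, constantCoeff (m i) = 0) (hF₀ : ∀ i, constantCoeff (F i) = 0)
    (hF₀' : ∀ i, constantCoeff (F' i) = 0) (hF : ∀ i, F i = m i * (G i).subst F)
    (hF' : ∀ i, F' i = m i * (G i).subst F') : F = F' := by
  refine funext fun i => eq_of_forall_natCast_le_order_sub fun k => ?_
  induction k generalizing i with
  | zero => simp
  | succ k ih =>
    rw [hF i, hF' i]
    exact natCast_add_one_le_order_mul_subst_sub hm hF₀ hF₀' ih G i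

theorem exists_eq_mul_subst (hm : ∀ i, constantCoeff (m i) = 0) (G : σ → MvPowerSeries σ R) :
    ∃ F : σ → MvPowerSeries τ R,
      (∀ i, constantCoeff (F i) = 0) ∧ ∀ i, F i = m i * (G i).subst F := by
  let approx (k : ℕ) : σ → MvPowerSeries τ R := (fun F i => m i * (G i).subst F)^[k] 0
  have approx_succ (k : ℕ) (i : σ) : approx (k + 1) i = m i * (G i).subst (approx k) :=
    congrFun (Function.iterate_succ_apply' _ k _) i
  have happrox₀ (k : ℕ) (i : σ) : constantCoeff (approx k i) = 0 := by
    cases k with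
    | zero => exact map_zero _
    | succ k => rw [approx_succ, map_mul, hm, zero_mul]
  have happrox (k : ℕ) (i : σ) : (k : ℕ∞) ≤ (approx (k + 1) i - approx k i).order := by
    induction k generalizing i with
    | zero => simp
    | succ k ih =>
      rw [approx_succ (k + 1), approx_succ k]
      exact natCast_add_one_le_order_mul_subst_sub hm (happrox₀ _) (happrox₀ _) ih G i
  choose F hF using fun i => exists_forall_natCast_le_order_sub (approx · i) (happrox · i)
  have hF₀ (i : σ) : constantCoeff (F i) = 0 := by
    have h := one_le_order_iff_constCoeff_eq_zero.mp (hF i 1)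
    rwa [map_sub, happrox₀, sub_zero] at h
  refine ⟨F, hF₀, fun i => eq_of_forall_natCast_le_order_sub fun k => ?_⟩
  have hlimit : ((k + 1 : ℕ) : ℕ∞) ≤ (F i - m i * (G i).subst F).order := by
    refine natCast_le_order_sub_trans (hF i (k + 1)) ?_
    rw [approx_succ, ← neg_sub, order_neg]
    exact natCast_add_one_le_order_mul_subst_sub hm hF₀ (happrox₀ k) (hF · k) G i
  exact (Nat.cast_le.mpr k.le_succ).trans hlimit

theorem existsUnique_eq_mul_subst (hm : ∀ i, constantCoeff (m i) = 0)
    (G : σ → MvPowerSeries σ R) :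
    ∃! F : σ → MvPowerSeries τ R,
      (∀ i, constantCoeff (F i) = 0) ∧ ∀ i, F i = m i * (G i).subst F := by
  obtain ⟨F, hF₀, hF⟩ := exists_eq_mul_subst hm G
  exact ⟨F, ⟨hF₀, hF⟩, fun F' h => eq_of_eq_mul_subst hm h.1 hF₀ h.2 hF⟩

end ImplicitEquation

section DiagonalSeries

variable {σ R : Type*} [Fintype σ] [CommRing R]

/-- The series `∑_γ X^γ [u^γ] (H G^γ)`, where `[u^γ]` is the coefficient of `u^γ` in a power
series in `u`, as a linear function of `H`. The Lagrange–Good formula evaluates it, and its value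
at `H = 1` is the partition function. -/
noncomputable def diagonalSeries (G : σ → MvPowerSeries σ R) :
    MvPowerSeries σ R →ₗ[R] MvPowerSeries σ R :=
  LinearMap.pi fun γ => coeff γ ∘ₗ LinearMap.mulRight R (∏ i, G i ^ γ i)

variable (G : σ → MvPowerSeries σ R)

theorem coeff_diagonalSeries (H : MvPowerSeries σ R) (γ : σ →₀ ℕ) :
    coeff γ (diagonalSeries G H) = coeff γ (H * ∏ i, G i ^ γ i) :=
  rfl

theorem diagonalSeries_X_mul (i : σ) (H : MvPowerSeries σ R) :
    diagonalSeries G (X i * H) = X i * diagonalSeries G (G i * H) := by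
  classical
  ext γ
  rw [coeff_diagonalSeries, X_def, mul_assoc, coeff_monomial_mul, coeff_monomial_mul]
  split_ifs with h
  · obtain ⟨δ, rfl⟩ := exists_add_of_le h
    have hpow : ∏ j, G j ^ (Finsupp.single i 1 + δ : σ →₀ ℕ) j = G i * ∏ j, G j ^ δ j := by
      simp only [Finsupp.add_apply, pow_add, Finset.prod_mul_distrib]
      congr 1
      rw [Finset.prod_eq_single i] <;> simp +contextual [eq_comm]
    rw [add_tsub_cancel_left, coeff_diagonalSeries, hpow, mul_left_comm, mul_assoc]
  · rfl

theorem order_le_order_diagonalSeries (H : MvPowerSeries σ R) :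
    H.order ≤ (diagonalSeries G H).order := by
  refine le_order fun γ hγ => ?_
  rw [coeff_diagonalSeries]
  exact coeff_of_lt_order (hγ.trans_le (le_self_add.trans le_order_mul))

variable {G} {F : σ → MvPowerSeries σ R}

/- The defect `E H = D H - H(F) D 1` is linear, does not decrease the order, and satisfies
`E (X i * p) = X i * E (p * G i)`: as it vanishes on constants, each step of the induction raises
its order by one. -/
theorem diagonalSeries_eq_subst_mul (hF₀ : ∀ i, constantCoeff (F i) = 0)
    (hF : ∀ i, F i = X i * (G i).subst F) (H : MvPowerSeries σ R) :
    diagonalSeries G H = H.subst F * diagonalSeries G 1 := by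
  have hs : HasSubst F := hasSubst_of_constantCoeff_zero hF₀
  let E : MvPowerSeries σ R →ₗ[R] MvPowerSeries σ R :=
    diagonalSeries G - (LinearMap.mulRight R (diagonalSeries G 1)) ∘ₗ (substAlgHom hs).toLinearMap
  have E_apply (H : MvPowerSeries σ R) :
      E H = diagonalSeries G H - H.subst F * diagonalSeries G 1 := by
    simp [E]
  have E_C (r : R) : E (C r) = 0 := by
    rw [E_apply, subst_C, ← smul_eq_C_mul, ← map_smul, smul_eq_C_mul, mul_one, sub_self]
  have E_mul_X (p : MvPowerSeries σ R) (i : σ) : E (p * X i) = X i * E (p * G i) := by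
    rw [E_apply, E_apply, mul_comm p, diagonalSeries_X_mul, subst_mul hs, subst_mul hs, subst_X hs,
      mul_comm (G i)]
    linear_combination (-(p.subst F * diagonalSeries G 1)) * hF i
  have order_le_order_E (H : MvPowerSeries σ R) : H.order ≤ (E H).order := by
    rw [E_apply, sub_eq_add_neg]
    refine (le_min (order_le_order_diagonalSeries G H) ?_).trans min_order_le_add
    rw [order_neg]
    exact (order_le_order_subst hs hF₀ H).trans (le_self_add.trans le_order_mul)
  refine eq_of_forall_natCast_le_order_sub fun k => ?_
  rw [← E_apply]
  induction k generalizing H with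
  | zero => simp
  | succ k ih =>
    have hpoly (p : MvPolynomial σ R) : ((k + 1 : ℕ) : ℕ∞) ≤ (E p).order := by
      induction p using MvPolynomial.induction_on with
      | C r => simp [E_C]
      | add p q hp hq =>
        rw [MvPolynomial.coe_add, map_add]
        exact (le_min hp hq).trans min_order_le_add
      | mul_X p i =>
        rw [MvPolynomial.coe_mul, MvPolynomial.coe_X, E_mul_X]
        exact natCast_add_one_le_order_mul (constantCoeff_X i) (ih _)
    rw [← sub_add_cancel H (truncTotal (k + 1) H : MvPowerSeries σ R), map_add]
    have hrest := (natCast_le_order_sub_truncTotal H (k + 1)).trans (order_le_order_E _)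
    exact (le_min hrest (hpoly _)).trans min_order_le_add

end DiagonalSeries

section Determinant

variable {σ R : Type*} [CommRing R]

theorem coeff_X_mul_pderiv (i : σ) (f : MvPowerSeries σ R) (d : σ →₀ ℕ) :
    coeff d (X i * pderiv R i f) = d i * coeff d f := by
  classical
  rw [X_def, coeff_monomial_mul]
  split_ifs with h
  · obtain ⟨e, rfl⟩ := exists_add_of_le h
    rw [add_tsub_cancel_left, coeff_pderiv, add_comm e]
    simp [add_comm, mul_comm]
  · have hd : d i = 0 := by simpa using h
    rw [hd, Nat.cast_zero, zero_mul]

theorem prod_X_eq_monomial (t : Finset σ) :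
    ∏ i ∈ t, (X i : MvPowerSeries σ R) = monomial (∑ i ∈ t, Finsupp.single i 1) 1 := by
  simp only [X_def, prod_monomial, Finset.prod_const_one]

theorem sum_single_one_apply [DecidableEq σ] (t : Finset σ) (i : σ) :
    (∑ j ∈ t, Finsupp.single j 1 : σ →₀ ℕ) i = if i ∈ t then 1 else 0 := by
  simp [Finsupp.finsetSum_apply, Finsupp.single_apply]

theorem coeff_prod_X_mul_diagonalSeries [Fintype σ] [DecidableEq σ]
    (G : σ → MvPowerSeries σ R) (t : Finset σ) (H : MvPowerSeries σ R) (γ : σ →₀ ℕ) :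
    coeff γ ((∏ i ∈ t, X i) * diagonalSeries G H) =
      coeff γ (H * ((∏ i ∈ Finset.univ \ t, G i ^ γ i) *
        ∏ i ∈ t, if γ i = 0 then 0 else X i * G i ^ (γ i - 1))) := by
  rw [prod_X_eq_monomial]
  by_cases hle : ∑ i ∈ t, Finsupp.single i 1 ≤ γ
  · obtain ⟨δ, rfl⟩ := exists_add_of_le hle
    have hout : ∏ i ∈ Finset.univ \ t, G i ^ (∑ i ∈ t, Finsupp.single i 1 + δ : σ →₀ ℕ) i =
        ∏ i ∈ Finset.univ \ t, G i ^ δ i :=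
      Finset.prod_congr rfl fun i hi => by
        rw [Finsupp.add_apply, sum_single_one_apply, if_neg (Finset.mem_sdiff.mp hi).2, zero_add]
    have hin : (∏ i ∈ t, if (∑ i ∈ t, Finsupp.single i 1 + δ : σ →₀ ℕ) i = 0 then 0 else
          X i * G i ^ ((∑ i ∈ t, Finsupp.single i 1 + δ : σ →₀ ℕ) i - 1)) =
        (∏ i ∈ t, X i) * ∏ i ∈ t, G i ^ δ i := by
      rw [← Finset.prod_mul_distrib]
      refine Finset.prod_congr rfl fun i hi => ?_
      rw [Finsupp.add_apply, sum_single_one_apply, if_pos hi, if_neg (by lia),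
        Nat.add_sub_cancel_left]
    rw [hout, hin, mul_left_comm _ (∏ i ∈ t, X i), Finset.prod_sdiff (Finset.subset_univ t),
      prod_X_eq_monomial, mul_left_comm, coeff_add_monomial_mul, coeff_add_monomial_mul,
      coeff_diagonalSeries]
  · obtain ⟨i, hi⟩ := not_forall.mp hle
    rw [sum_single_one_apply] at hi
    have hit : i ∈ t := by
      by_contra h
      simp [h] at hi
    have hγ : γ i = 0 := by simpa [hit] using hi
    have hzero : (∏ i ∈ t, if γ i = 0 then 0 else X i * G i ^ (γ i - 1)) = 0 :=
      Finset.prod_eq_zero hit (if_pos hγ)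
    rw [coeff_monomial_mul, if_neg hle, hzero, mul_zero, mul_zero, map_zero]

theorem coeff_prod_sub_X_mul_mul_diagonalSeries [Fintype σ] {G F : σ → MvPowerSeries σ R}
    (hF₀ : ∀ i, constantCoeff (F i) = 0) (hF : ∀ i, F i = X i * (G i).subst F)
    (a b : σ → MvPowerSeries σ R) (γ : σ →₀ ℕ) :
    coeff γ ((∏ i, ((a i).subst F - X i * (b i).subst F)) * diagonalSeries G 1) =
      coeff γ (∏ i, (a i * G i ^ γ i -
        if γ i = 0 then 0 else X i * (b i * G i ^ (γ i - 1)))) := by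
  classical
  have hs : HasSubst F := hasSubst_of_constantCoeff_zero hF₀
  have coeff_sign_mul (m : ℕ) (f : MvPowerSeries σ R) :
      coeff γ ((-1) ^ m * f) = (-1) ^ m * coeff γ f := by
    rw [← coeff_C_mul, map_pow, map_neg, map_one]
  rw [Finset.prod_sub, Finset.prod_sub, Finset.sum_mul, map_sum, map_sum]
  refine Finset.sum_congr rfl fun t _ => ?_
  let H : MvPowerSeries σ R := (∏ i ∈ Finset.univ \ t, a i) * ∏ i ∈ t, b i
  have hleft : (∏ i ∈ Finset.univ \ t, (a i).subst F) * (∏ i ∈ t, X i * (b i).subst F) *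
      diagonalSeries G 1 = (∏ i ∈ t, X i) * diagonalSeries G H := by
    rw [diagonalSeries_eq_subst_mul hF₀ hF H, ← coe_substAlgHom hs, map_mul, map_prod, map_prod,
      Finset.prod_mul_distrib]
    ring
  have hright : (∏ i ∈ Finset.univ \ t, a i * G i ^ γ i) *
        (∏ i ∈ t, if γ i = 0 then 0 else X i * (b i * G i ^ (γ i - 1))) =
      H * ((∏ i ∈ Finset.univ \ t, G i ^ γ i) *
        ∏ i ∈ t, if γ i = 0 then 0 else X i * G i ^ (γ i - 1)) := by
    have hpull (i : σ) : (if γ i = 0 then 0 else X i * (b i * G i ^ (γ i - 1))) =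
        b i * if γ i = 0 then 0 else X i * G i ^ (γ i - 1) := by
      rw [mul_ite, mul_zero, mul_left_comm]
    simp only [hpull, Finset.prod_mul_distrib, H]
    ring
  rw [mul_assoc, mul_assoc, mul_assoc, coeff_sign_mul, coeff_sign_mul, ← mul_assoc, hleft, hright,
    coeff_prod_X_mul_diagonalSeries]

variable [DecidableEq σ]

/-- The matrix with entries `δᵢⱼ Gᵢ^γᵢ - Xᵢ ∂ⱼGᵢ Gᵢ^(γᵢ - 1)`, where the second term is read as `0`
if `γᵢ = 0`. The coefficient of `X^γ` in `det (1 - X∂G(F)) * diagonalSeries G 1` is the one of its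
determinant. -/
noncomputable def lagrangeMatrix (G : σ → MvPowerSeries σ R) (γ : σ →₀ ℕ) :
    Matrix σ σ (MvPowerSeries σ R) :=
  Matrix.of fun i j => (1 : Matrix σ σ (MvPowerSeries σ R)) i j * G i ^ γ i -
    if γ i = 0 then 0 else X i * (pderiv R j (G i) * G i ^ (γ i - 1))

theorem lagrangeMatrix_zero (G : σ → MvPowerSeries σ R) : lagrangeMatrix G 0 = 1 := by
  ext1 i j
  simp [lagrangeMatrix]

theorem X_mul_intCast_mul_lagrangeMatrix {γ : σ →₀ ℕ} {w : σ → ℤ}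
    (hw : ∀ i, γ i ≠ 0 → w i = γ i) (G : σ → MvPowerSeries σ R) (i j : σ) :
    X j * ((w i : MvPowerSeries σ R) * lagrangeMatrix G γ i j) =
      X i * (((Matrix.diagonal w i j : ℤ) : MvPowerSeries σ R) * G i ^ γ i -
        X j * pderiv R j (G i ^ γ i)) := by
  rw [lagrangeMatrix, Matrix.of_apply, pderiv_pow, Matrix.diagonal_apply, Matrix.one_apply]
  by_cases hi : γ i = 0
  · by_cases hij : i = j
    · subst hij
      simp [hi]
    · simp [hi, hij]
  · rw [if_neg hi, hw i hi, Int.cast_natCast]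
    by_cases hij : i = j
    · subst hij
      simp only [if_true, Int.cast_natCast]
      ring
    · simp only [if_neg hij, Int.cast_zero]
      ring

variable [Fintype σ]

theorem coeff_det_mul_diagonalSeries_one {G F : σ → MvPowerSeries σ R}
    (hF₀ : ∀ i, constantCoeff (F i) = 0) (hF : ∀ i, F i = X i * (G i).subst F) (γ : σ →₀ ℕ) :
    coeff γ ((1 - Matrix.of fun i j => X i * (pderiv R j (G i)).subst F).det *
      diagonalSeries G 1) = coeff γ (lagrangeMatrix G γ).det := by
  have hs : HasSubst F := hasSubst_of_constantCoeff_zero hF₀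
  have subst_one_apply (i j : σ) : ((1 : Matrix σ σ (MvPowerSeries σ R)) i j).subst F =
      (1 : Matrix σ σ (MvPowerSeries σ R)) i j := by
    rw [← coe_substAlgHom hs, Matrix.one_apply, apply_ite (substAlgHom hs), map_one, map_zero]
  rw [← Matrix.det_transpose, ← Matrix.det_transpose (lagrangeMatrix G γ), Matrix.det_apply,
    Matrix.det_apply, Finset.sum_mul, map_sum, map_sum]
  refine Finset.sum_congr rfl fun π _ => ?_
  rw [smul_mul_assoc, Units.smul_def, Units.smul_def, map_zsmul, map_zsmul]
  simp only [Matrix.transpose_apply, Matrix.sub_apply, Matrix.of_apply, lagrangeMatrix]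
  rw [← coeff_prod_sub_X_mul_mul_diagonalSeries hF₀ hF
    (fun i => (1 : Matrix σ σ (MvPowerSeries σ R)) i (π i)) (fun i => pderiv R (π i) (G i)) γ]
  simp only [subst_one_apply]

theorem coeff_det_intCast_mul_sub_X_mul_pderiv (c : Matrix σ σ ℤ) (E : σ → MvPowerSeries σ R)
    (γ : σ →₀ ℕ) :
    coeff γ (Matrix.of fun i j => (c i j : MvPowerSeries σ R) * E i - X j * pderiv R j (E i)).det =
      ∑ l ∈ Finset.univ.finsuppAntidiag γ,
        ((c - Matrix.of fun i j => (l i j : ℤ)).det : R) * ∏ i, coeff (l i) (E i) := by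
  have hentry (i j : σ) (d : σ →₀ ℕ) :
      coeff d ((c i j : MvPowerSeries σ R) * E i - X j * pderiv R j (E i)) =
        ((c i j - d j : ℤ) : R) * coeff d (E i) := by
    rw [map_sub, coeff_X_mul_pderiv, ← zsmul_eq_mul, map_zsmul, zsmul_eq_mul, ← sub_mul,
      Int.cast_sub, Int.cast_natCast]
  have hdet (l : σ → σ →₀ ℕ) : ((c - Matrix.of fun i j => (l i j : ℤ)).det : R) =
      ∑ π : Equiv.Perm σ, Equiv.Perm.sign π • ∏ i, ((c i (π i) - l i (π i) : ℤ) : R) := by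
    rw [← Matrix.det_transpose, Matrix.det_apply, Int.cast_sum]
    refine Finset.sum_congr rfl fun π _ => ?_
    simp only [Units.smul_def, Matrix.transpose_apply, Matrix.sub_apply, Matrix.of_apply,
      zsmul_eq_mul, Int.cast_mul, Int.cast_prod, Int.cast_id]
  rw [← Matrix.det_transpose, Matrix.det_apply, map_sum]
  simp only [Units.smul_def, map_zsmul, Matrix.transpose_apply, Matrix.of_apply, coeff_prod,
    hentry, Finset.prod_mul_distrib, hdet, Finset.smul_sum, Finset.sum_mul, smul_mul_assoc]
  exact Finset.sum_comm

/- The indicator vector of the support of `γ` is in the left kernel of the matrix. -/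
theorem det_diagonal_sub_eq_zero {γ : σ →₀ ℕ} {w : σ → ℤ} {l : σ → σ →₀ ℕ} (hγ : γ ≠ 0)
    (hw : ∀ i, γ i ≠ 0 → w i = γ i) (hl : ∑ i, l i = γ) (hl₀ : ∀ i, γ i = 0 → l i = 0) :
    (Matrix.diagonal w - Matrix.of fun i j => (l i j : ℤ)).det = 0 := by
  refine Matrix.exists_vecMul_eq_zero_iff.mp ⟨fun i => if γ i = 0 then 0 else 1, ?_, ?_⟩
  · obtain ⟨i, hi⟩ := Finsupp.ne_iff.mp hγ
    intro h
    simpa [show γ i ≠ 0 from hi] using congrFun h i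
  · funext j
    have hterm (i : σ) : (if γ i = 0 then (0 : ℤ) else 1) *
        (Matrix.diagonal w i j - l i j) = (if i = j then (γ i : ℤ) else 0) - l i j := by
      by_cases h : γ i = 0
      · simp [h, hl₀ i h]
      · simp [h, hw i h, Matrix.diagonal_apply]
    simp only [Matrix.vecMul, dotProduct, Matrix.sub_apply, Matrix.of_apply, hterm,
      Finset.sum_sub_distrib, Finset.sum_ite_eq', Finset.mem_univ, if_true, Pi.zero_apply]
    rw [← Nat.cast_sum, ← Finsupp.finsetSum_apply, hl, sub_self]

theorem coeff_det_diagonal_mul_sub_X_mul_pderiv_eq_zero {γ : σ →₀ ℕ} {w : σ → ℤ}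
    {E : σ → MvPowerSeries σ R} (hγ : γ ≠ 0) (hw : ∀ i, γ i ≠ 0 → w i = γ i)
    (hE : ∀ i, γ i = 0 → E i = 1) :
    coeff γ (Matrix.of fun i j =>
      ((Matrix.diagonal w i j : ℤ) : MvPowerSeries σ R) * E i -
        X j * pderiv R j (E i)).det = 0 := by
  rw [coeff_det_intCast_mul_sub_X_mul_pderiv]
  refine Finset.sum_eq_zero fun l hl => ?_
  by_cases hl₀ : ∀ i, γ i = 0 → l i = 0
  · rw [det_diagonal_sub_eq_zero hγ hw (Finset.mem_finsuppAntidiag.mp hl).1 hl₀, Int.cast_zero,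
      zero_mul]
  · push Not at hl₀
    obtain ⟨i, hi, hli⟩ := hl₀
    rw [Finset.prod_eq_zero (Finset.mem_univ i), mul_zero]
    rw [hE i hi, coeff_one, if_neg hli]

theorem det_eq_det_of_mul_eq_mul {A : Type*} [CommRing A] {x : σ → A}
    (hx : ∀ i, x i ∈ nonZeroDivisors A) {M N : Matrix σ σ A}
    (h : ∀ i j, x j * M i j = x i * N i j) : M.det = N.det := by
  refine (mul_cancel_left_mem_nonZeroDivisors (prod_mem fun i _ => hx i)).mp
    (?_ : (∏ i, x i) * M.det = _ )
  rw [← Matrix.det_mul_row, ← Matrix.det_mul_column]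
  simp only [h]

theorem coeff_det_lagrangeMatrix_eq_zero [IsAddTorsionFree R] (G : σ → MvPowerSeries σ R)
    {γ : σ →₀ ℕ} (hγ : γ ≠ 0) : coeff γ (lagrangeMatrix G γ).det = 0 := by
  let w (i : σ) : ℤ := if γ i = 0 then 1 else γ i
  have hw : ∀ i, γ i ≠ 0 → w i = γ i := fun i hi => if_neg hi
  have hdet : (∏ i, (w i : MvPowerSeries σ R)) * (lagrangeMatrix G γ).det =
      (Matrix.of fun i j => ((Matrix.diagonal w i j : ℤ) : MvPowerSeries σ R) * G i ^ γ i -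
        X j * pderiv R j (G i ^ γ i)).det := by
    rw [← Matrix.det_mul_column]
    exact det_eq_det_of_mul_eq_mul (x := fun i => (X i : MvPowerSeries σ R))
      (fun _ => X_mem_nonzeroDivisors) (X_mul_intCast_mul_lagrangeMatrix hw G)
  have hcoeff : (∏ i, w i) • coeff γ (lagrangeMatrix G γ).det = 0 := by
    rw [← map_zsmul, zsmul_eq_mul, Int.cast_prod, hdet]
    exact coeff_det_diagonal_mul_sub_X_mul_pderiv_eq_zero hγ hw fun i hi => by rw [hi, pow_zero]
  have hprod : ∏ i, w i ≠ 0 := Finset.prod_ne_zero_iff.mpr fun i _ => by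
    by_cases hi : γ i = 0 <;> simp [w, hi]
  exact (smul_eq_zero_iff_right hprod).mp hcoeff

theorem det_one_sub_mul_diagonalSeries_one [IsAddTorsionFree R] {G F : σ → MvPowerSeries σ R}
    (hF₀ : ∀ i, constantCoeff (F i) = 0) (hF : ∀ i, F i = X i * (G i).subst F) :
    (1 - Matrix.of fun i j => X i * (pderiv R j (G i)).subst F).det * diagonalSeries G 1 = 1 := by
  ext γ
  rw [coeff_det_mul_diagonalSeries_one hF₀ hF]
  obtain rfl | hγ := eq_or_ne γ 0
  · rw [lagrangeMatrix_zero, Matrix.det_one]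
  · rw [coeff_det_lagrangeMatrix_eq_zero G hγ, coeff_one, if_neg hγ]

end Determinant

section Gaussian

open scoped Nat

variable {n : ℕ} {R : Type*} [CommRing R]

theorem gaussMonomial_one_self (α : Fin n →₀ ℕ) :
    gaussMonomial (1 : GL (Fin n) R) α α = ((∏ i, (α i)! : ℕ) : R) := by
  have hterm (σ : (Σ i, Fin (α i)) ≃ (Σ i, Fin (α i))) :
      ∏ k : Σ i, Fin (α i), (1 : Matrix (Fin n) (Fin n) R) (σ k).1 k.1 =
        if Sigma.fst ∘ σ = Sigma.fst then 1 else 0 := by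
    simp only [Matrix.one_apply, Finset.prod_ite_zero, Finset.prod_const_one, Finset.mem_univ,
      true_imp_iff, funext_iff, Function.comp_apply]
  have hcard (i : Fin n) : Fintype.card {a : Σ i, Fin (α i) // a.1 = i} = α i := by
    rw [Fintype.card_congr (Equiv.sigmaSubtype i), Fintype.card_fin]
  have h := DomMulAct.stabilizer_card (Sigma.fst : (Σ i, Fin (α i)) → Fin n)
  simp only [hcard] at h
  simp only [gaussMonomial, inv_one, map_one, Units.val_one, one_mul, hterm, Finset.sum_boole]
  rw [← h, Fintype.card_subtype]

theorem gaussMonomial_one_of_ne {α β : Fin n →₀ ℕ} (h : α ≠ β) :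
    gaussMonomial (1 : GL (Fin n) R) α β = 0 := by
  simp only [gaussMonomial, inv_one, map_one, Units.val_one, one_mul]
  refine Finset.sum_eq_zero fun σ _ => ?_
  by_contra hσ
  have hfst (k : Σ i, Fin (α i)) : (σ k).1 = k.1 := by
    by_contra hk
    exact hσ (Finset.prod_eq_zero (Finset.mem_univ k) (Matrix.one_apply_ne hk))
  refine h (Finsupp.ext fun i => ?_)
  have e : {a : Σ i, Fin (α i) // a.1 = i} ≃ {a : Σ i, Fin (β i) // a.1 = i} :=
    σ.subtypeEquiv fun a => by rw [hfst]
  simpa using Fintype.card_congr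
    (((Equiv.sigmaSubtype i).symm.trans e).trans (Equiv.sigmaSubtype i))

end Gaussian

section Exponential

open scoped Nat

variable {n : ℕ} {R : Type*} [CommRing R]

/-- The inclusion of the variables `uᵢ` into all variables. -/
def uEmbedding (n : ℕ) : Fin n ↪ Var n :=
  Function.Embedding.inl.trans Function.Embedding.inr

theorem subst_uvar (g : MvPowerSeries (Fin n) R) :
    g.subst (uvar : Fin n → BigRing n R) = rename (uEmbedding n) g :=
  (rename_eq_subst (uEmbedding n) g).symm

theorem embDomain_uEmbedding (β : Fin n →₀ ℕ) :
    β.embDomain (uEmbedding n) = (0 : Fin n →₀ ℕ).sumElim (β.sumElim 0) := by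
  rw [uEmbedding, Finsupp.embDomain_trans_apply, Finsupp.embDomain_inl, Finsupp.embDomain_inr]

theorem eq_zero_of_sumElim_mem_range_mapDomain {α β γ : Fin n →₀ ℕ}
    (h : α.sumElim (β.sumElim γ) ∈ Set.range (Finsupp.mapDomain (uEmbedding n))) :
    α = 0 ∧ γ = 0 := by
  obtain ⟨δ, hδ⟩ := h
  rw [← Finsupp.embDomain_eq_mapDomain, embDomain_uEmbedding] at hδ
  refine ⟨Finsupp.ext fun i => ?_, Finsupp.ext fun i => ?_⟩
  · exact (DFunLike.congr_fun hδ (Sum.inl i)).symm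
  · exact (DFunLike.congr_fun hδ (Sum.inr (Sum.inr i))).symm

theorem coeff_monomial_mul_rename (κ α β γ : Fin n →₀ ℕ) (g : MvPowerSeries (Fin n) R) :
    coeff (α.sumElim (β.sumElim γ))
      (monomial (κ.sumElim ((0 : Fin n →₀ ℕ).sumElim κ)) 1 * rename (uEmbedding n) g) =
      if κ = α ∧ κ = γ then coeff β g else 0 := by
  rw [coeff_monomial_mul]
  by_cases h : κ = α ∧ κ = γ
  · obtain ⟨rfl, rfl⟩ := h
    have hsub : κ.sumElim (β.sumElim κ) - κ.sumElim ((0 : Fin n →₀ ℕ).sumElim κ) =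
        β.embDomain (uEmbedding n) := by
      rw [embDomain_uEmbedding]
      ext (i | i | i) <;> simp
    rw [if_pos, if_pos ⟨rfl, rfl⟩, hsub, coeff_embDomain_rename, one_mul]
    rintro (i | i | i) <;> simp
  · rw [if_neg h]
    split_ifs with hle
    · rw [one_mul, coeff_rename_eq_zero]
      intro hmem
      have hsub : α.sumElim (β.sumElim γ) - κ.sumElim ((0 : Fin n →₀ ℕ).sumElim κ) =
          (α - κ).sumElim (β.sumElim (γ - κ)) := by
        ext (i | i | i) <;> simp
      rw [hsub] at hmem
      obtain ⟨hα, hγ⟩ := eq_zero_of_sumElim_mem_range_mapDomain hmem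
      refine h ⟨le_antisymm (fun i => ?_) (tsub_eq_zero_iff_le.mp hα),
        le_antisymm (fun i => ?_) (tsub_eq_zero_iff_le.mp hγ)⟩
      · simpa using hle (Sum.inl i)
      · simpa using hle (Sum.inr (Sum.inr i))
    · rfl

theorem prod_ubar_mul_xvar_mul_subst_pow (G : Fin n → MvPowerSeries (Fin n) R) (κ : Fin n →₀ ℕ) :
    ∏ i, (ubar i * xvar i * (G i).subst (uvar : Fin n → BigRing n R)) ^ κ i =
      monomial (κ.sumElim ((0 : Fin n →₀ ℕ).sumElim κ)) 1 *
        rename (uEmbedding n) (∏ i, G i ^ κ i) := by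
  simp only [mul_pow, Finset.prod_mul_distrib, subst_uvar, map_prod, map_pow]
  congr 1
  rw [monomial_one_eq, Finsupp.prod_fintype _ _ (fun _ => pow_zero _), Fintype.prod_sum_type,
    Fintype.prod_sum_type]
  simp [ubar, xvar]

theorem coeff_action_pow (G : Fin n → MvPowerSeries (Fin n) R) (m : ℕ) (α β γ : Fin n →₀ ℕ) :
    coeff (α.sumElim (β.sumElim γ)) (action G ^ m) =
      if α.degree = m ∧ α = γ then
        (Nat.multinomial Finset.univ α : R) * coeff β (∏ i, G i ^ α i) else 0 := by
  rw [action, Finset.sum_pow_eq_sum_piAntidiag, map_sum]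
  have hterm (k : Fin n → ℕ) : coeff (α.sumElim (β.sumElim γ))
      ((Nat.multinomial Finset.univ k : BigRing n R) *
        ∏ i, (ubar i * xvar i * (G i).subst (uvar : Fin n → BigRing n R)) ^ k i) =
      if k = α ∧ α = γ then (Nat.multinomial Finset.univ α : R) * coeff β (∏ i, G i ^ α i)
        else 0 := by
    have h := prod_ubar_mul_xvar_mul_subst_pow G (Finsupp.equivFunOnFinite.symm k)
    simp only [Finsupp.equivFunOnFinite_symm_apply_apply] at h
    rw [h, ← nsmul_eq_mul, map_nsmul, nsmul_eq_mul, coeff_monomial_mul_rename]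
    by_cases hk : k = α
    · subst hk
      simp
    · have : Finsupp.equivFunOnFinite.symm k ≠ α := fun h => hk (by simp [← h])
      simp [hk, this]
  simp only [hterm]
  by_cases hγ : α = γ
  · simp only [hγ, and_true, Finset.sum_ite_eq', Finset.mem_piAntidiag]
    simp [Finsupp.degree_eq_sum]
  · simp [hγ]

theorem constantCoeff_action (G : Fin n → MvPowerSeries (Fin n) R) :
    constantCoeff (action G) = 0 := by
  simp [action, ubar]

variable [Algebra ℚ R]

theorem factorial_mul_coeff_exp (d : ℕ) :
    (d ! : R) * PowerSeries.coeff d (PowerSeries.exp R) = 1 := by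
  rw [PowerSeries.coeff_exp, ← map_natCast (algebraMap ℚ R), ← map_mul,
    mul_one_div_cancel (Nat.cast_ne_zero.mpr (Nat.factorial_ne_zero d)), map_one]

theorem prod_factorial_mul_coeff_expAction (G : Fin n → MvPowerSeries (Fin n) R)
    (α β γ : Fin n →₀ ℕ) :
    ((∏ i, (α i)! : ℕ) : R) * coeff (α.sumElim (β.sumElim γ)) (expAction G) =
      if α = γ then coeff β (∏ i, G i ^ α i) else 0 := by
  have hfac : (∏ i, (α i)!) * Nat.multinomial Finset.univ α = α.degree ! := by
    rw [Nat.multinomial_spec, Finsupp.degree_eq_sum]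
  have hdegree (m : ℕ) (hm : m ≠ α.degree) :
      PowerSeries.coeff m (PowerSeries.exp R) •
        coeff (α.sumElim (β.sumElim γ)) (action G ^ m) = 0 := by
    rw [coeff_action_pow, if_neg fun h => hm h.1.symm, smul_zero]
  rw [expAction, PowerSeries.coeff_subst
    (PowerSeries.HasSubst.of_constantCoeff_zero (constantCoeff_action G)),
    finsum_eq_single _ α.degree hdegree, coeff_action_pow, smul_eq_mul]
  by_cases h : α = γ
  · rw [if_pos ⟨rfl, h⟩, if_pos h, mul_left_comm, ← mul_assoc _ _ (coeff β _), ← Nat.cast_mul,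
      hfac, ← mul_assoc, mul_comm (PowerSeries.coeff _ _), factorial_mul_coeff_exp, one_mul]
  · rw [if_neg fun h' => h h'.2, if_neg h, mul_zero, mul_zero]

theorem coeff_gaussTerm_expAction (G : Fin n → MvPowerSeries (Fin n) R)
    (p : (Fin n →₀ ℕ) × (Fin n →₀ ℕ)) (γ : Fin n →₀ ℕ) :
    coeff γ (gaussTerm 1 (expAction G) p) =
      if p = (γ, γ) then coeff γ (∏ i, G i ^ γ i) else 0 := by
  obtain ⟨α, β⟩ := p
  have hcoeff : coeff γ (coeffX (expAction G) α β) =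
      coeff (α.sumElim (β.sumElim γ)) (expAction G) := coeff_apply _ γ
  rw [gaussTerm, coeff_C_mul, hcoeff]
  by_cases h : α = β
  · subst h
    rw [gaussMonomial_one_self, prod_factorial_mul_coeff_expAction]
    exact if_ctx_congr (by simp) (by rintro ⟨⟩; rfl) fun _ => rfl
  · rw [gaussMonomial_one_of_ne h, zero_mul, if_neg]
    rintro ⟨⟩
    exact h rfl

open scoped MvPowerSeries.WithPiTopology

theorem hasSum_gaussTerm_expAction [TopologicalSpace R] (G : Fin n → MvPowerSeries (Fin n) R) :
    HasSum (gaussTerm 1 (expAction G)) (diagonalSeries G 1) := by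
  rw [WithPiTopology.hasSum_iff_hasSum_coeff]
  intro γ
  simp only [coeff_gaussTerm_expAction, coeff_diagonalSeries, one_mul]
  exact hasSum_ite_eq (γ, γ) _

theorem gaussIntegrable_expAction (G : Fin n → MvPowerSeries (Fin n) R) :
    GaussIntegrable 1 (expAction G) :=
  let : TopologicalSpace R := ⊥
  (hasSum_gaussTerm_expAction G).summable

theorem partitionFunction_eq_diagonalSeries (G : Fin n → MvPowerSeries (Fin n) R) :
    partitionFunction G = diagonalSeries G 1 := by
  let : TopologicalSpace R := ⊥
  have : DiscreteTopology R := ⟨rfl⟩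
  have : T2Space (MvPowerSeries (Fin n) R) := WithPiTopology.instT2Space
  exact (hasSum_gaussTerm_expAction G).tsum_eq

end Exponential

end LagrangeGood

theorem theorem7 (n : ℕ) (R : Type*) [CommRing R] [Algebra ℚ R]
    (G : Fin n → MvPowerSeries (Fin n) R) :
    (∃! F : Fin n → MvPowerSeries (Fin n) R, LagrangeGood.IsImplicitSolution G F) ∧
    LagrangeGood.GaussIntegrable 1 (LagrangeGood.expAction G) ∧
    ∀ F : Fin n → MvPowerSeries (Fin n) R, LagrangeGood.IsImplicitSolution G F →
      IsUnit (1 - LagrangeGood.xJacobian G F).det ∧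
      LagrangeGood.partitionFunction G =
        Ring.inverse (1 - LagrangeGood.xJacobian G F).det := by
  have : IsAddTorsionFree R := .of_module_rat R
  refine ⟨LagrangeGood.existsUnique_eq_mul_subst MvPowerSeries.constantCoeff_X G,
    LagrangeGood.gaussIntegrable_expAction G, fun F ⟨hF₀, hF⟩ => ?_⟩
  have hmul : (1 - LagrangeGood.xJacobian G F).det * LagrangeGood.partitionFunction G = 1 := by
    rw [LagrangeGood.partitionFunction_eq_diagonalSeries]
    exact LagrangeGood.det_one_sub_mul_diagonalSeries_one hF₀ hF
  have hunit : IsUnit (1 - LagrangeGood.xJacobian G F).det := .of_mul_eq_one _ hmul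
  exact ⟨hunit, hunit.mul_left_cancel (hmul.trans (Ring.mul_inverse_cancel _ hunit).symm)⟩
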